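/- Let $n\ge 2$ and let $\pi:\mathbb R^n\to\mathbb R$ be the projection onto the first coordinate. A \emph{domain of finite type} is a closed subset $\mathscr D\subset\mathbb R^n$ that is a $C^\infty$ submanifold with boundary of dimension $n$, such that $\pi|_{\partial\mathscr D}$ is a Morse function with finitely many critical values and $\pi|_{\mathscr D}$ is proper. Its \emph{Poincaré–Reeb space} is the quotient space $\widetilde{\mathscr D}=\mathscr D/\!\sim$, with quotient map $\rho$, where $x\sim y$ if and only if $x$ and $y$ lie in the same connected component of $\mathscr D\cap\pi^{-1}(\pi(x))$; the function on $\widetilde{\mathscr D}$ induced by $\pi$ is again denoted by $\pi$. The \emph{Poincaré–Reeb graph} $\mathcal R(\mathscr D)$ is $\widetilde{\mathscr D}$ with the following (multi)graph structure. The vertices are the points $\rho(p)$ with $p$ a critical point of $\pi|_{\partial\mathscr D}$. For vertices $v,w$ with $\pi(v)<\pi(w)$, there is one edge between $v$ and $w$, with interior $\rho(K)$, for each connected component $K$ of $\mathscr D\cap\pi^{-1}(]\pi(v),\pi(w)[)$ that contains no critical point of $\pi|_{\partial\mathscr D}$ and whose closure meets both $\rho^{-1}(v)$ and $\rho^{-1}(w)$.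 There is one unbounded edge at a vertex $v$ for each unbounded connected component $K$ of $\mathscr D\cap\pi^{-1}(]-\infty,\pi(v)[)$ or of $\mathscr D\cap\pi^{-1}(]\pi(v),+\infty[)$ that contains no critical point of $\pi|_{\partial\mathscr D}$ and whose closure meets $\rho^{-1}(v)$, and one unbounded edge without vertices for each unbounded connected component of $\mathscr D$ containing no critical point of $\pi|_{\partial\mathscr D}$. Let $\Gamma=(V,E)$ be a multigraph without unbounded edges, with topological realization $|\Gamma|$. We say that $\Gamma$ \emph{is realized as} $\mathcal R(\mathscr D)$ if $\mathcal R(\mathscr D)$ has no unbounded edges and there are an isomorphism of graphs from $\Gamma$ to $\mathcal R(\mathscr D)$ and a homeomorphism $\varphi:|\Gamma|\to\widetilde{\mathscr D}$ mapping each vertex to the corresponding vertex and each open edge onto the corresponding $\rho(K)$. The graph $\mathcal R(\mathscr D)$ may be viewed inside $\mathbb R^n$ through a topological embedding $j:|\Gamma|\to\mathbb R^n$ compatible with $\pi$, that is, such that $\pi\circ j=\pi\circ\varphi$. A function $h:|\Gamma|\to\mathbb R$ is a \emph{good orientation} of $\Gamma$ if it is continuous, is strictly monotonic on each edge, and its local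 extrema are exactly the vertices of degree $1$. \textbf{Corollary.} Let $\Gamma$ be a multigraph without unbounded edges. If $\Gamma$ is realized as the Poincaré–Reeb graph $\mathcal R(\mathscr D)$ of a domain of finite type $\mathscr D\subset\mathbb R^n$, then $\pi|_{\mathcal R(\mathscr D)}$ is a good orientation of $\Gamma$: the function $\pi\circ\varphi$ is a good orientation of $\Gamma$, and so is $\pi\circ j$ for every embedding $j:|\Gamma|\to\mathbb R^n$ compatible with $\pi$. -/

import Mathlib

open scoped ContDiff

/-! ### Domains of finite type in `ℝ^(m+1)` -/

/-- Euclidean space `ℝⁿ`. -/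
abbrev Euc (n : ℕ) : Type := EuclideanSpace ℝ (Fin n)

/-- The projection `π : ℝ^(m+1) → ℝ` onto the first coordinate. -/
def proj {m : ℕ} (x : Euc (m + 1)) : ℝ := x 0

/-- `Φ` is a boundary chart of `D`: a smooth diffeomorphism between open subsets of `ℝ^(m+1)` and
`ℝ × ℝ^m` which carries `D` to the half-space `{(t, y) | 0 ≤ t}`. -/
def IsBoundaryChart {m : ℕ} (D : Set (Euc (m + 1)))
    (Φ : OpenPartialHomeomorph (Euc (m + 1)) (ℝ × Euc m)) : Prop :=
  ContDiffOn ℝ ∞ Φ Φ.source ∧ ContDiffOn ℝ ∞ Φ.symm Φ.target ∧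
    ∀ x ∈ Φ.source, x ∈ D ↔ 0 ≤ (Φ x).1

/-- `D` is a closed subset of `ℝ^(m+1)` which is a smooth submanifold with boundary of dimension
`m + 1`. Its boundary `∂D` is the topological frontier of `D`; no chart is needed at the other points
of `D`, since they have a neighbourhood in `ℝ^(m+1)` contained in `D`. -/
def IsClosedSmoothDomain {m : ℕ} (D : Set (Euc (m + 1))) : Prop :=
  IsClosed D ∧ ∀ p ∈ frontier D, ∃ Φ, IsBoundaryChart D Φ ∧ p ∈ Φ.source

/-- The function `π|_{∂D}` in the local coordinates `y ∈ ℝ^m` of `∂D` given by a boundary chart. -/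
def chartHeight {m : ℕ} (Φ : OpenPartialHomeomorph (Euc (m + 1)) (ℝ × Euc m)) (y : Euc m) : ℝ :=
  proj (Φ.symm (0, y))

/-- `p` is a critical point of `π|_{∂D}`. -/
def IsCriticalPt {m : ℕ} (D : Set (Euc (m + 1))) (p : Euc (m + 1)) : Prop :=
  p ∈ frontier D ∧ ∃ Φ, IsBoundaryChart D Φ ∧ p ∈ Φ.source ∧
    fderiv ℝ (chartHeight Φ) (Φ p).2 = 0

/-- `p` is a nondegenerate critical point of `π|_{∂D}`: in local coordinates the first derivative
vanishes and the Hessian is a nondegenerate bilinear form. -/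
def IsNondegenerateCriticalPt {m : ℕ} (D : Set (Euc (m + 1))) (p : Euc (m + 1)) : Prop :=
  p ∈ frontier D ∧ ∃ Φ, IsBoundaryChart D Φ ∧ p ∈ Φ.source ∧
    fderiv ℝ (chartHeight Φ) (Φ p).2 = 0 ∧
    ∀ v : Euc m,
      (∀ w : Euc m, fderiv ℝ (fderiv ℝ (chartHeight Φ)) (Φ p).2 v w = 0) → v = 0

/-- Domain of finite type: `π|_{∂D}` is a Morse function with finitely many critical values and
`π|_D` is proper. -/
structure IsDomainOfFiniteType {m : ℕ} (D : Set (Euc (m + 1))) : Prop where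
  smooth : IsClosedSmoothDomain D
  morse : ∀ p, IsCriticalPt D p → IsNondegenerateCriticalPt D p
  finite_criticalValues : (proj '' {p | IsCriticalPt D p}).Finite
  proper : IsProperMap fun x : D => proj (x : Euc (m + 1))

/-! ### The Poincaré-Reeb space and its graph structure -/

/-- `D ∩ π⁻¹(I)`. -/
def slab {m : ℕ} (D : Set (Euc (m + 1))) (I : Set ℝ) : Set (Euc (m + 1)) :=
  D ∩ proj ⁻¹' I

/-- `x ∼ y` iff `x` and `y` lie in the same connected component of `D ∩ π⁻¹(π(x))`. -/
def reebSetoid {m : ℕ} (D : Set (Euc (m + 1))) : Setoid D where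
  r x y := (y : Euc (m + 1)) ∈ connectedComponentIn (slab D {proj (x : Euc (m + 1))}) x
  iseqv :=
    { refl := fun x => mem_connectedComponentIn ⟨x.2, rfl⟩
      symm := by
        intro x y h
        have hy : proj (y : Euc (m + 1)) = proj (x : Euc (m + 1)) :=
          (connectedComponentIn_subset _ _ h).2
        rw [hy, ← connectedComponentIn_eq h]
        exact mem_connectedComponentIn ⟨x.2, rfl⟩
      trans := by
        intro x y z h h'
        have hy : proj (y : Euc (m + 1)) = proj (x : Euc (m + 1)) :=
          (connectedComponentIn_subset _ _ h).2
        rw [hy, ← connectedComponentIn_eq h] at h'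
        exact h' }

/-- The Poincaré-Reeb space of `D`, with the quotient topology. -/
abbrev ReebSpace {m : ℕ} (D : Set (Euc (m + 1))) : Type := Quotient (reebSetoid D)

/-- The quotient map `ρ`. -/
def reebMk {m : ℕ} (D : Set (Euc (m + 1))) (x : D) : ReebSpace D := Quotient.mk (reebSetoid D) x

/-- The function induced by `π` on the Poincaré-Reeb space. -/
def reebHeight {m : ℕ} (D : Set (Euc (m + 1))) : ReebSpace D → ℝ :=
  Quotient.lift (fun x : D => proj (x : Euc (m + 1)))
    fun _ _ h => ((connectedComponentIn_subset _ _ h).2 : _ = _).symm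

/-- The connected component of a level set of `π|_D` which is the point `q` of the Reeb space. -/
def reebFiber {m : ℕ} (D : Set (Euc (m + 1))) (q : ReebSpace D) : Set (Euc (m + 1)) :=
  Subtype.val '' (reebMk D ⁻¹' {q})

/-- The vertices of the Poincaré-Reeb graph: the points of the Reeb space represented by the critical
points of `π|_{∂D}`. -/
def ReebVertex {m : ℕ} (D : Set (Euc (m + 1))) : Type :=
  {q : ReebSpace D // ∃ p : D, IsCriticalPt D p ∧ reebMk D p = q}

/-- `K` is a connected component of `S` containing no critical point of `π|_{∂D}`. -/
def IsRegularComponent {m : ℕ} (D S K : Set (Euc (m + 1))) : Prop :=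
  (∃ x ∈ S, K = connectedComponentIn S x) ∧ ∀ p ∈ K, ¬ IsCriticalPt D p

/-- A bounded edge of the Poincaré-Reeb graph, from the vertex `lo` up to the vertex `hi`: a connected
component, without critical points, of the part of `D` strictly between the two levels, whose closure
meets both of the components of level sets represented by `lo` and `hi`. -/
structure ReebEdge {m : ℕ} (D : Set (Euc (m + 1))) where
  lo : ReebVertex D
  hi : ReebVertex D
  carrier : Set (Euc (m + 1))
  lt : reebHeight D lo.1 < reebHeight D hi.1
  component : IsRegularComponent D (slab D (Set.Ioo (reebHeight D lo.1) (reebHeight D hi.1))) carrier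
  closure_lo : (closure carrier ∩ reebFiber D lo.1).Nonempty
  closure_hi : (closure carrier ∩ reebFiber D hi.1).Nonempty

/-- `K` is an unbounded edge of the Poincaré-Reeb graph: either a half-line attached to one vertex
`v`, coming from below or from above, or a full line, attached to no vertex. -/
def IsUnboundedReebEdge {m : ℕ} (D K : Set (Euc (m + 1))) : Prop :=
  ¬ Bornology.IsBounded K ∧
    ((∃ v : ReebVertex D,
        (IsRegularComponent D (slab D (Set.Iio (reebHeight D v.1))) K ∨
          IsRegularComponent D (slab D (Set.Ioi (reebHeight D v.1))) K) ∧
        (closure K ∩ reebFiber D v.1).Nonempty) ∨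
      IsRegularComponent D D K)

/-! ### Graphs, their realizations and good orientations -/

/-- A (multi)graph without unbounded edges. Each edge joins the two vertices `src e` and `tgt e`,
listed in an arbitrary order; loops and parallel edges are allowed. -/
structure MGraph (V E : Type*) where
  src : E → V
  tgt : E → V

namespace MGraph

variable {V E : Type*}

/-- The degree of a vertex (a loop counts twice). -/
noncomputable def degree (Γ : MGraph V E) (v : V) : ℕ∞ :=
  {e | Γ.src e = v}.encard + {e | Γ.tgt e = v}.encard

/-- The disjoint union of one point for each vertex and one copy of `[0,1]` for each edge. -/
abbrev Pieces (_Γ : MGraph V E) : Type _ := (Σ _ : V, Unit) ⊕ (Σ _ : E, unitInterval)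

/-- The gluing of the ends of the edges to the vertices. -/
inductive Glue (Γ : MGraph V E) : Γ.Pieces → Γ.Pieces → Prop
  | src (e : E) : Glue Γ (Sum.inr ⟨e, 0⟩) (Sum.inl ⟨Γ.src e, ()⟩)
  | tgt (e : E) : Glue Γ (Sum.inr ⟨e, 1⟩) (Sum.inl ⟨Γ.tgt e, ()⟩)

/-- The topological realization `|Γ|`, with the quotient topology. -/
abbrev Realization (Γ : MGraph V E) : Type _ := Quot Γ.Glue

/-- A vertex as a point of `|Γ|`. -/
def vertex (Γ : MGraph V E) (v : V) : Γ.Realization := Quot.mk _ (Sum.inl ⟨v, ()⟩)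

/-- The parametrization of an edge of `|Γ|` by `[0,1]`. -/
def edge (Γ : MGraph V E) (e : E) (t : unitInterval) : Γ.Realization :=
  Quot.mk _ (Sum.inr ⟨e, t⟩)

/-- `h : |Γ| → ℝ` is a good orientation: it is continuous, strictly monotonic on each edge, and its
(local) extrema are the vertices of degree `1`. -/
structure IsGoodOrientation (Γ : MGraph V E) (h : Γ.Realization → ℝ) : Prop where
  continuous : Continuous h
  strict_on_edge : ∀ e, StrictMono (h ∘ Γ.edge e) ∨ StrictAnti (h ∘ Γ.edge e)
  extrema : ∀ p, IsLocalExtr h p ↔ ∃ v, Γ.vertex v = p ∧ Γ.degree v = 1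

end MGraph

/-- `Γ` is realized as the Poincaré-Reeb graph of `D`: the latter has no unbounded edge, and there is an
isomorphism of graphs between `Γ` and the graph of vertices and edges above, together with a
homeomorphism from `|Γ|` to the Poincaré-Reeb space which respects this graph structure. -/
structure ReebRealization {V E : Type*} (Γ : MGraph V E) {m : ℕ} (D : Set (Euc (m + 1))) where
  no_unbounded_edge : ∀ K, ¬ IsUnboundedReebEdge D K
  onVertices : V ≃ ReebVertex D
  onEdges : E ≃ ReebEdge D
  ends : ∀ e, s(onVertices (Γ.src e), onVertices (Γ.tgt e)) = s((onEdges e).lo, (onEdges e).hi)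
  homeo : Γ.Realization ≃ₜ ReebSpace D
  homeo_vertex : ∀ v, homeo (Γ.vertex v) = (onVertices v).1
  homeo_edge : ∀ e, homeo '' (Γ.edge e '' Set.Ioo 0 1) =
    reebMk D '' {x : D | (x : Euc (m + 1)) ∈ (onEdges e).carrier}

/-- `j : |Γ| → ℝ^(m+1)` is an embedding of the Poincaré-Reeb graph (realized by `Γ`) in `ℝ^(m+1)`,
compatible with the projection `π`; its image is then the embedded Poincaré-Reeb graph. -/
structure ReebRealization.IsCompatibleEmbedding {V E : Type*} {Γ : MGraph V E} {m : ℕ}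
    {D : Set (Euc (m + 1))} (R : ReebRealization Γ D) (j : Γ.Realization → Euc (m + 1)) : Prop where
  isEmbedding : Topology.IsEmbedding j
  proj_eq : ∀ p, proj (j p) = reebHeight D (R.homeo p)

/-! Let `h` be the height on the Reeb space, carried to `|Γ|` by the homeomorphism. Suppose `h` has
a local extremum at the class of `x`. Then `π|_D` has a local extremum at every point of the level
component `C` of `x`. As `π` has no critical points in `ℝ^(m+1)`, all of `C` lies in `∂D` and
consists of critical points of `π|_{∂D}`. Nondegenerate critical points are isolated and `C` is
connected, so `C = {x}` (`isCriticalPt_and_eq_of_isLocalExtr`). In particular the class of `x` is a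
vertex.

Hence `h` has no local extremum inside an edge, and by Rolle it is injective, so strictly monotonic,
on each edge.

At an extremal vertex, `D` looks near `x` like a half-ball, which stays connected when `x` is
removed. Since the fibre is the single point `x` and `π|_D` is proper, `ρ` carries neighbourhoods of
`x` to neighbourhoods of the vertex (`image_toGraph_mem_nhds`). The vertex therefore has arbitrarily
small connected punctured neighbourhoods, so only one half-edge ends there
(`degree_eq_one_of_isPreconnected`). Conversely, at a vertex of degree `1`, monotonicity on its only
edge makes it an extremum. -/

open Topology Filter

/-! ### Topology of `|Γ|` and monotonicity on edges -/

namespace MGraph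

variable {V E : Type*} (Γ : MGraph V E)

theorem edge_zero (e : E) : Γ.edge e 0 = Γ.vertex (Γ.src e) := Quot.sound (Glue.src e)

theorem edge_one (e : E) : Γ.edge e 1 = Γ.vertex (Γ.tgt e) := Quot.sound (Glue.tgt e)

theorem continuous_edge (e : E) : Continuous (Γ.edge e) :=
  continuous_quot_mk.comp (continuous_inr.comp continuous_sigmaMk)

-- The vertex pieces are discrete, so only the edges test openness.
variable {Γ} in
theorem isOpen_iff_edge {S : Set Γ.Realization} :
    IsOpen S ↔ ∀ e, IsOpen (Γ.edge e ⁻¹' S) := by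
  refine ⟨fun h e => h.preimage (Γ.continuous_edge e), fun h => ?_⟩
  rw [← isQuotientMap_quot_mk.isOpen_preimage, isOpen_sum_iff]
  refine ⟨isOpen_sigma_iff.2 fun _ => isOpen_discrete _, isOpen_sigma_iff.2 h⟩

theorem exists_vertex_or_edge (p : Γ.Realization) :
    (∃ v, p = Γ.vertex v) ∨ ∃ e t, p = Γ.edge e t := by
  induction p using Quot.ind with
  | mk a =>
    rcases a with ⟨v, _⟩ | ⟨e, t⟩
    · exact Or.inl ⟨v, rfl⟩
    · exact Or.inr ⟨e, t, rfl⟩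

/-- The points of the interiors of the edges with parameters in `T`. -/
def interiorSet (T : E → Set unitInterval) : Set Γ.Realization :=
  {p | Quot.lift (Sum.elim (fun _ => False) fun x : Σ _ : E, unitInterval =>
      x.2 ∈ Set.Ioo 0 1 ∧ x.2 ∈ T x.1)
    (by rintro _ _ (e | e) <;> simp) p}

@[simp]
theorem edge_mem_interiorSet {T : E → Set unitInterval} {e : E} {t : unitInterval} :
    Γ.edge e t ∈ Γ.interiorSet T ↔ t ∈ Set.Ioo 0 1 ∧ t ∈ T e := Iff.rfl

@[simp]
theorem vertex_notMem_interiorSet {T : E → Set unitInterval} {v : V} :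
    Γ.vertex v ∉ Γ.interiorSet T := id

theorem isOpen_interiorSet {T : E → Set unitInterval} (hT : ∀ e, IsOpen (T e)) :
    IsOpen (Γ.interiorSet T) :=
  isOpen_iff_edge.2 fun e => isOpen_Ioo.inter (hT e)

theorem edge_ne_vertex {e : E} {t : unitInterval} (ht : t ∈ Set.Ioo 0 1) (v : V) :
    Γ.edge e t ≠ Γ.vertex v := by
  intro h
  have h1 : Γ.edge e t ∈ Γ.interiorSet fun _ => Set.univ := by simpa using ht
  rw [h] at h1
  exact Γ.vertex_notMem_interiorSet h1

theorem map_edge_nhds {e : E} {t : unitInterval} (ht : t ∈ Set.Ioo 0 1) :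
    𝓝 (Γ.edge e t) ≤ map (Γ.edge e) (𝓝 t) := by
  classical
  intro S hS
  obtain ⟨U, hUS, hU, htU⟩ := mem_nhds_iff.1 (mem_map.1 hS)
  have hop : IsOpen (Γ.interiorSet fun e' => {s | e' = e ∧ s ∈ U}) :=
    Γ.isOpen_interiorSet fun e' => by by_cases h : e' = e <;> simp [h, hU]
  refine mem_of_superset (hop.mem_nhds ⟨ht, rfl, htU⟩) fun p hp => ?_
  rcases Γ.exists_vertex_or_edge p with ⟨v, rfl⟩ | ⟨e', s, rfl⟩
  · exact (Γ.vertex_notMem_interiorSet hp).elim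
  · obtain ⟨-, rfl, hs⟩ := hp
    exact hUS hs

/-- A continuous function on `|Γ|` without local extrema inside the edges is strictly monotonic on
each edge. -/
theorem strictMono_or_strictAnti_edge {h : Γ.Realization → ℝ} (hc : Continuous h)
    (hext : ∀ p, IsLocalExtr h p → ∃ v, Γ.vertex v = p) (e : E) :
    StrictMono (h ∘ Γ.edge e) ∨ StrictAnti (h ∘ Γ.edge e) := by
  have hce := hc.comp (Γ.continuous_edge e)
  -- A continuous injective function on an interval is strictly monotonic. Equal values at two
  -- points would give, by Rolle, an extremum strictly between them, hence inside the edge.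
  refine hce.strictMono_of_inj_boundedOrder' ?_
  have key : ∀ a b : unitInterval, a < b → h (Γ.edge e a) ≠ h (Γ.edge e b) := by
    intro a b hab heq
    obtain ⟨c, hc, hcl⟩ := exists_isLocalExtr_Ioo (f := Set.IccExtend zero_le_one (h ∘ Γ.edge e))
      (a := a) (b := b) hab (hce.Icc_extend' (h := zero_le_one)).continuousOn (by simpa using heq)
    have hcI : c ∈ Set.Icc (0 : ℝ) 1 := ⟨a.2.1.trans hc.1.le, hc.2.le.trans b.2.2⟩
    have hc' : (⟨c, hcI⟩ : unitInterval) ∈ Set.Ioo 0 1 :=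
      ⟨lt_of_le_of_lt (show (0 : unitInterval) ≤ a from a.2.1) (show a < ⟨c, hcI⟩ from hc.1),
        lt_of_lt_of_le (show ⟨c, hcI⟩ < b from hc.2) (show b ≤ 1 from b.2.2)⟩
    have h1 : IsLocalExtr (h ∘ Γ.edge e) ⟨c, hcI⟩ := by
      have := IsLocalExtr.comp_continuous (g := ((↑) : unitInterval → ℝ)) (b := ⟨c, hcI⟩) hcl
        continuous_subtype_val.continuousAt
      simpa [Function.comp_def] using this
    have h2 : IsLocalExtr h (Γ.edge e ⟨c, hcI⟩) := by
      have hle := Γ.map_edge_nhds (e := e) hc'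
      rcases h1 with h1 | h1
      · exact Or.inl (hle h1)
      · exact Or.inr (hle h1)
    obtain ⟨v, hv⟩ := hext _ h2
    exact Γ.edge_ne_vertex hc' v hv.symm
  intro a b hab
  rcases lt_trichotomy a b with hlt | heq | hlt
  · exact (key a b hlt hab).elim
  · exact heq
  · exact (key b a hlt hab.symm).elim

/-- In the quotient topology, neighbourhoods of the ends can be chosen independently on each edge,
even when infinitely many edges meet at `v`. -/
theorem eventually_nhds_vertex {v : V} {P : Γ.Realization → Prop} (hv : P (Γ.vertex v))
    (hsrc : ∀ e, Γ.src e = v → ∀ᶠ t in 𝓝 0, P (Γ.edge e t))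
    (htgt : ∀ e, Γ.tgt e = v → ∀ᶠ t in 𝓝 1, P (Γ.edge e t)) :
    ∀ᶠ p in 𝓝 (Γ.vertex v), P p := by
  have hs : ∀ e, ∃ U : Set unitInterval, IsOpen U ∧ (0 ∈ U ↔ Γ.src e = v) ∧ 1 ∉ U ∧
      ∀ t ∈ U, P (Γ.edge e t) := by
    intro e
    by_cases h : Γ.src e = v
    · obtain ⟨U, hU, ho, h0⟩ := mem_nhds_iff.1 (hsrc e h)
      -- The other end is removed so that the union of the chosen sets is compatible with the
      -- gluing: it contains an end exactly when that end is glued to `v`.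
      exact ⟨U ∩ {1}ᶜ, ho.inter isOpen_compl_singleton, by simp [h, h0], by simp,
        fun t ht => hU ht.1⟩
    · exact ⟨∅, isOpen_empty, by simp [h], by simp, by simp⟩
  have ht : ∀ e, ∃ U : Set unitInterval, IsOpen U ∧ (1 ∈ U ↔ Γ.tgt e = v) ∧ 0 ∉ U ∧
      ∀ t ∈ U, P (Γ.edge e t) := by
    intro e
    by_cases h : Γ.tgt e = v
    · obtain ⟨U, hU, ho, h0⟩ := mem_nhds_iff.1 (htgt e h)
      exact ⟨U ∩ {0}ᶜ, ho.inter isOpen_compl_singleton, by simp [h, h0], by simp,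
        fun t ht => hU ht.1⟩
    · exact ⟨∅, isOpen_empty, by simp [h], by simp, by simp⟩
  choose U hUo hU0 hU1 hUP using hs
  choose W hWo hW1 hW0 hWP using ht
  let S : Set Γ.Realization := {p | Quot.lift (Sum.elim (fun x : Σ _ : V, Unit => x.1 = v)
    fun x : Σ _ : E, unitInterval => x.2 ∈ U x.1 ∪ W x.1)
    (by rintro _ _ (e | e) <;> simp [*]) p}
  have hS : IsOpen S := isOpen_iff_edge.2 fun e => (hUo e).union (hWo e)
  refine mem_of_superset (hS.mem_nhds (rfl : v = v)) fun p hp => ?_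
  rcases Γ.exists_vertex_or_edge p with ⟨w, rfl⟩ | ⟨e, t, rfl⟩
  · obtain rfl : w = v := hp
    exact hv
  · rcases hp with h | h
    exacts [hUP _ _ h, hWP _ _ h]

/-- A function which is strictly monotonic on each edge has a local extremum at each vertex of
degree `1`. -/
theorem isLocalExtr_of_degree_eq_one {h : Γ.Realization → ℝ}
    (hmono : ∀ e, StrictMono (h ∘ Γ.edge e) ∨ StrictAnti (h ∘ Γ.edge e)) {v : V}
    (hv : Γ.degree v = 1) : IsLocalExtr h (Γ.vertex v) := by
  rcases Set.eq_empty_or_nonempty {e | Γ.src e = v} with hs | ⟨e, he⟩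
  · have ht : {e | Γ.tgt e = v}.encard = 1 := by simpa [degree, hs] using hv
    obtain ⟨e, he⟩ := Set.encard_eq_one.1 ht
    have hs' : ∀ e, Γ.src e ≠ v := fun e he => (hs.subset he).elim
    have hv1 : Γ.edge e 1 = Γ.vertex v := by
      rw [edge_one, show Γ.tgt e = v from he.superset rfl]
    rcases hmono e with hm | hm
    · refine Or.inr (Γ.eventually_nhds_vertex le_rfl (fun e h => (hs' e h).elim) ?_)
      rintro e' he'
      obtain rfl : e' = e := he.subset he'
      exact Eventually.of_forall fun t => hv1 ▸ hm.monotone unitInterval.le_one'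
    · refine Or.inl (Γ.eventually_nhds_vertex le_rfl (fun e h => (hs' e h).elim) ?_)
      rintro e' he'
      obtain rfl : e' = e := he.subset he'
      exact Eventually.of_forall fun t => hv1 ▸ hm.antitone unitInterval.le_one'
  · have h1 : 1 ≤ {e | Γ.src e = v}.encard := Set.one_le_encard_iff_nonempty.2 ⟨e, he⟩
    -- The degree counts both kinds of ends, so one outgoing end leaves no room for an incoming one;
    -- this excludes loops.
    have ht0 : {e | Γ.tgt e = v}.encard = 0 := by
      by_contra h0
      have h2 : 1 ≤ {e | Γ.tgt e = v}.encard := Order.one_le_iff_ne_zero.2 h0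
      have h3 := add_le_add h1 h2
      rw [show _ + _ = (1 : ℕ∞) from hv] at h3
      exact absurd h3 (by decide)
    have hs : {e | Γ.src e = v}.encard = 1 := by simpa [degree, ht0] using hv
    have ht' : ∀ e, Γ.tgt e ≠ v := fun e he => ((Set.encard_eq_zero.1 ht0).subset he).elim
    obtain ⟨e, he⟩ := Set.encard_eq_one.1 hs
    have hv0 : Γ.edge e 0 = Γ.vertex v := by
      rw [edge_zero, show Γ.src e = v from he.superset rfl]
    rcases hmono e with hm | hm
    · refine Or.inl (Γ.eventually_nhds_vertex le_rfl ?_ (fun e h => (ht' e h).elim))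
      rintro e' he'
      obtain rfl : e' = e := he.subset he'
      exact Eventually.of_forall fun t => hv0 ▸ hm.monotone unitInterval.nonneg'
    · refine Or.inr (Γ.eventually_nhds_vertex le_rfl ?_ (fun e h => (ht' e h).elim))
      rintro e' he'
      obtain rfl : e' = e := he.subset he'
      exact Eventually.of_forall fun t => hv0 ▸ hm.antitone unitInterval.nonneg'

/-! ### A continuous distance to a vertex -/

open Classical in
/-- The distance to the vertex `v`, truncated at `1`, when each edge has length `1`. -/
noncomputable def vertexDist (v : V) : Γ.Realization → ℝ :=
  Quot.lift (Sum.elim (fun x : Σ _ : V, Unit => if x.1 = v then 0 else 1)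
    fun x : Σ _ : E, unitInterval => min (if Γ.src x.1 = v then (x.2 : ℝ) else 1)
      (if Γ.tgt x.1 = v then 1 - (x.2 : ℝ) else 1)) (by
    rintro _ _ (e | e)
    · by_cases h : Γ.src e = v <;> by_cases h' : Γ.tgt e = v <;> simp [h, h']
    · by_cases h : Γ.src e = v <;> by_cases h' : Γ.tgt e = v <;> simp [h, h'])

open Classical in
theorem vertexDist_edge (v : V) (e : E) (t : unitInterval) :
    Γ.vertexDist v (Γ.edge e t) = min (if Γ.src e = v then (t : ℝ) else 1)
      (if Γ.tgt e = v then 1 - (t : ℝ) else 1) := rfl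

open Classical in
theorem vertexDist_vertex (v w : V) :
    Γ.vertexDist v (Γ.vertex w) = if w = v then 0 else 1 := rfl

theorem continuous_vertexDist (v : V) : Continuous (Γ.vertexDist v) := by
  refine continuous_quot_lift _ (Continuous.sumElim (continuous_sigma fun w => continuous_of_discreteTopology)
    (continuous_sigma fun e => ?_))
  by_cases h : Γ.src e = v <;> by_cases h' : Γ.tgt e = v <;> simp only [h, h', if_true, if_false] <;>
    fun_prop

theorem vertexDist_nonneg (v : V) (p : Γ.Realization) : 0 ≤ Γ.vertexDist v p := by
  classical
  rcases Γ.exists_vertex_or_edge p with ⟨w, rfl⟩ | ⟨e, t, rfl⟩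
  · rw [vertexDist_vertex]; split_ifs <;> simp
  · rw [vertexDist_edge]
    have := t.2.1; have := t.2.2
    refine le_min ?_ ?_ <;> split_ifs <;> linarith

theorem vertexDist_eq_zero {v : V} {p : Γ.Realization} (h : Γ.vertexDist v p = 0) :
    p = Γ.vertex v := by
  classical
  rcases Γ.exists_vertex_or_edge p with ⟨w, rfl⟩ | ⟨e, t, rfl⟩
  · rw [vertexDist_vertex] at h
    by_cases hw : w = v
    · rw [hw]
    · simp [hw] at h
  · rw [vertexDist_edge] at h
    rcases min_choice (if Γ.src e = v then (t : ℝ) else 1)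
      (if Γ.tgt e = v then 1 - (t : ℝ) else 1) with hm | hm <;> rw [hm] at h <;> split_ifs at h with hv
    · obtain rfl : t = 0 := Subtype.ext h
      rw [edge_zero, hv]
    · simp at h
    · obtain rfl : t = 1 := Subtype.ext (by simpa using (sub_eq_zero.1 h).symm)
      rw [edge_one, hv]
    · simp at h

end MGraph

/-! ### Half-edges and a criterion for degree one -/

namespace MGraph

variable {V E : Type*} (Γ : MGraph V E)

/-- The vertex at the end `c.2` of the edge `c.1`. -/
def halfEdgeVertex (c : E × Bool) : V := if c.2 then Γ.tgt c.1 else Γ.src c.1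

/-- The open half of the edge `c.1` at its end `c.2`. -/
def halfEdge (c : E × Bool) : Set Γ.Realization :=
  Γ.interiorSet fun e => {t | e = c.1 ∧ if c.2 then 1 / 2 < (t : ℝ) else (t : ℝ) < 1 / 2}

theorem isOpen_halfEdge (c : E × Bool) : IsOpen (Γ.halfEdge c) := by
  refine Γ.isOpen_interiorSet fun e => ?_
  rcases c with ⟨e', _ | _⟩ <;> by_cases h : e = e' <;> simp only [h, false_and, true_and]
  · exact isOpen_lt continuous_subtype_val continuous_const
  · exact isOpen_empty
  · exact isOpen_lt continuous_const continuous_subtype_val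
  · exact isOpen_empty

theorem eq_of_mem_halfEdge {c c' : E × Bool} {p : Γ.Realization} (h : p ∈ Γ.halfEdge c)
    (h' : p ∈ Γ.halfEdge c') : c = c' := by
  rcases Γ.exists_vertex_or_edge p with ⟨w, rfl⟩ | ⟨e, t, rfl⟩
  · exact (Γ.vertex_notMem_interiorSet h).elim
  · obtain ⟨-, h1, h2⟩ := h
    obtain ⟨-, h1', h2'⟩ := h'
    rcases c with ⟨e1, _ | _⟩ <;> rcases c' with ⟨e2, _ | _⟩ <;> simp at h1 h2 h1' h2' ⊢
    · exact h1.symm.trans h1'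
    · linarith
    · linarith
    · exact h1.symm.trans h1'

theorem exists_mem_halfEdge {v : V} {p : Γ.Realization} (hp : Γ.vertexDist v p < 1 / 2)
    (hpv : p ≠ Γ.vertex v) : ∃ c, Γ.halfEdgeVertex c = v ∧ p ∈ Γ.halfEdge c := by
  classical
  rcases Γ.exists_vertex_or_edge p with ⟨w, rfl⟩ | ⟨e, t, rfl⟩
  · rw [vertexDist_vertex] at hp
    by_cases hw : w = v
    · exact (hpv (by rw [hw])).elim
    · norm_num [hw] at hp
  · have ht : t ∈ Set.Ioo 0 1 ∨ t = 0 ∨ t = 1 := by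
      rcases eq_or_lt_of_le (unitInterval.nonneg' (t := t)) with h | h
      · exact Or.inr (Or.inl h.symm)
      rcases eq_or_lt_of_le (unitInterval.le_one' (t := t)) with h' | h'
      · exact Or.inr (Or.inr h')
      exact Or.inl ⟨h, h'⟩
    rcases ht with ht | rfl | rfl
    · rw [vertexDist_edge, min_lt_iff] at hp
      rcases hp with hp | hp <;> split_ifs at hp with hv
      · exact ⟨(e, false), hv, ht, rfl, by simpa using hp⟩
      · norm_num at hp
      · exact ⟨(e, true), hv, ht, rfl, by simp; linarith⟩
      · norm_num at hp
    · rw [edge_zero] at hp hpv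
      rw [vertexDist_vertex, if_neg (fun h => hpv (by rw [h]))] at hp
      norm_num at hp
    · rw [edge_one] at hp hpv
      rw [vertexDist_vertex, if_neg (fun h => hpv (by rw [h]))] at hp
      norm_num at hp

/-- Points of the half-edge tend to `v` along the edge, so they eventually enter the neighbourhood.
-/
theorem inter_halfEdge_nonempty {v : V} {c : E × Bool} (hc : Γ.halfEdgeVertex c = v)
    {A : Set Γ.Realization} (hA : insert (Γ.vertex v) A ∈ 𝓝 (Γ.vertex v)) :
    (A ∩ Γ.halfEdge c).Nonempty := by
  suffices h : ∃ t, Γ.edge c.1 t ∈ insert (Γ.vertex v) A ∧ Γ.edge c.1 t ∈ Γ.halfEdge c by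
    obtain ⟨t, h | h, h'⟩ := h
    · rw [h] at h'
      exact (Γ.vertex_notMem_interiorSet h').elim
    · exact ⟨_, h, h'⟩
  rcases c with ⟨e, _ | _⟩
  · have h1 : ∀ᶠ t in 𝓝[>] (0 : unitInterval), Γ.edge e t ∈ insert (Γ.vertex v) A := by
      refine nhdsWithin_le_nhds ((Γ.continuous_edge e).continuousAt ?_)
      rw [edge_zero, show Γ.src e = v from hc]
      exact hA
    have h2 : ∀ᶠ t : unitInterval in 𝓝[>] 0, (t : ℝ) < 1 / 2 := by
      refine nhdsWithin_le_nhds ((isOpen_lt continuous_subtype_val continuous_const).mem_nhds ?_)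
      norm_num
    have : (𝓝[>] (0 : unitInterval)).NeBot := nhdsGT_neBot_of_exists_gt ⟨1, zero_lt_one⟩
    obtain ⟨t, ⟨h1, h2⟩, h0⟩ := ((h1.and h2).and self_mem_nhdsWithin).exists
    refine ⟨t, h1, ⟨h0, ?_⟩, rfl, by simpa using h2⟩
    exact Subtype.coe_lt_coe.1 (h2.trans (by norm_num))
  · have h1 : ∀ᶠ t in 𝓝[<] (1 : unitInterval), Γ.edge e t ∈ insert (Γ.vertex v) A := by
      refine nhdsWithin_le_nhds ((Γ.continuous_edge e).continuousAt ?_)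
      rw [edge_one, show Γ.tgt e = v from hc]
      exact hA
    have h2 : ∀ᶠ t : unitInterval in 𝓝[<] 1, 1 / 2 < (t : ℝ) := by
      refine nhdsWithin_le_nhds ((isOpen_lt continuous_const continuous_subtype_val).mem_nhds ?_)
      norm_num
    have : (𝓝[<] (1 : unitInterval)).NeBot := nhdsLT_neBot_of_exists_lt ⟨0, zero_lt_one⟩
    obtain ⟨t, ⟨h1, h2⟩, h0⟩ := ((h1.and h2).and self_mem_nhdsWithin).exists
    refine ⟨t, h1, ⟨?_, h0⟩, rfl, by simpa using h2⟩
    exact Subtype.coe_lt_coe.1 (lt_trans (by norm_num) h2)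

/-- A vertex with arbitrarily small nonempty connected punctured neighbourhoods has degree `1`. -/
theorem degree_eq_one_of_isPreconnected {v : V}
    (h : ∀ N ∈ 𝓝 (Γ.vertex v), ∃ A ⊆ N \ {Γ.vertex v}, IsPreconnected A ∧ A.Nonempty ∧
      insert (Γ.vertex v) A ∈ 𝓝 (Γ.vertex v)) : Γ.degree v = 1 := by
  classical
  -- Within distance `1 / 2`, the complement of `v` is covered by the disjoint open half-edges at
  -- `v`; a loop contributes two of them.
  obtain ⟨A, hAN, hA, ⟨p, hp⟩, hAv⟩ := h {p | Γ.vertexDist v p < 1 / 2}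
    ((isOpen_lt (Γ.continuous_vertexDist v) continuous_const).mem_nhds
      (by norm_num [vertexDist_vertex]))
  have hex := fun q (hq : q ∈ A) => Γ.exists_mem_halfEdge (hAN hq).1 (hAN hq).2
  obtain ⟨c₀, hc₀, hpc₀⟩ := hex p hp
  -- Connectedness confines `A` to one half-edge, while every half-edge at `v` must meet `A`.
  have hsub : A ⊆ Γ.halfEdge c₀ := by
    refine hA.subset_left_of_subset_union (v := ⋃ c ≠ c₀, Γ.halfEdge c) (Γ.isOpen_halfEdge c₀)
      (isOpen_biUnion fun c _ => Γ.isOpen_halfEdge c) ?_ ?_ ⟨p, hp, hpc₀⟩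
    · rw [Set.disjoint_left]
      intro q hq hq'
      obtain ⟨c, hc, hqc⟩ := Set.mem_iUnion₂.1 hq'
      exact hc (Γ.eq_of_mem_halfEdge hqc hq)
    · intro q hq
      obtain ⟨c, -, hqc⟩ := hex q hq
      by_cases h : c = c₀
      · exact Or.inl (h ▸ hqc)
      · exact Or.inr (Set.mem_iUnion₂.2 ⟨c, h, hqc⟩)
  have huniq : ∀ c, Γ.halfEdgeVertex c = v ↔ c = c₀ := by
    refine fun c => ⟨fun hc => ?_, fun hc => hc ▸ hc₀⟩
    obtain ⟨q, hqA, hqc⟩ := Γ.inter_halfEdge_nonempty hc hAv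
    exact Γ.eq_of_mem_halfEdge hqc (hsub hqA)
  have hs : ∀ e, Γ.src e = v ↔ (e, false) = c₀ := fun e => huniq (e, false)
  have ht : ∀ e, Γ.tgt e = v ↔ (e, true) = c₀ := fun e => huniq (e, true)
  rcases c₀ with ⟨e, _ | _⟩ <;> simp [degree, hs, ht]

end MGraph

/-! ### Local extrema of `π|_D` and critical points -/

section Domain

variable {m : ℕ} {D : Set (Euc (m + 1))}

theorem continuous_proj : Continuous (proj : Euc (m + 1) → ℝ) :=
  (EuclideanSpace.proj (𝕜 := ℝ) (0 : Fin (m + 1))).continuous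

theorem continuous_reebMk : Continuous (reebMk D) := continuous_quotient_mk'

theorem continuous_reebHeight : Continuous (reebHeight D) :=
  Continuous.quotient_lift (continuous_proj.comp continuous_subtype_val) _

theorem not_isLocalExtr_proj (x : Euc (m + 1)) : ¬ IsLocalExtr proj x := by
  intro h
  have h1 := h.hasFDerivAt_eq_zero
    (EuclideanSpace.proj (𝕜 := ℝ) (0 : Fin (m + 1))).hasFDerivAt
  have h2 := DFunLike.congr_fun h1 (EuclideanSpace.single 0 1)
  simp at h2

theorem isLocalExtrOn_proj_of_reebHeight {x : D} (h : IsLocalExtr (reebHeight D) (reebMk D x)) :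
    IsLocalExtrOn proj D (x : Euc (m + 1)) := by
  have h1 : IsLocalExtr (reebHeight D ∘ reebMk D) x :=
    h.comp_continuous continuous_reebMk.continuousAt
  unfold IsLocalExtrOn
  rw [← map_nhds_subtype_val]
  exact h1

theorem mem_frontier_of_isLocalExtrOn {x : Euc (m + 1)} (hx : x ∈ D)
    (h : IsLocalExtrOn proj D x) : x ∈ frontier D := by
  refine ⟨subset_closure hx, fun hi => not_isLocalExtr_proj x ?_⟩
  exact h.isLocalExtr (mem_interior_iff_mem_nhds.1 hi)

variable {Φ : OpenPartialHomeomorph (Euc (m + 1)) (ℝ × Euc m)}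

theorem IsBoundaryChart.symm_mem (hΦ : IsBoundaryChart D Φ) {z : ℝ × Euc m} (hz : z ∈ Φ.target)
    (h0 : 0 ≤ z.1) : Φ.symm z ∈ D := by
  rw [hΦ.2.2 _ (Φ.map_target hz), Φ.right_inv hz]
  exact h0

theorem IsBoundaryChart.fst_eq_zero (hΦ : IsBoundaryChart D Φ) {p : Euc (m + 1)} (hpD : p ∈ D)
    (hp : p ∈ frontier D) (hps : p ∈ Φ.source) : (Φ p).1 = 0 := by
  by_contra hne
  have hpos : 0 < (Φ p).1 := lt_of_le_of_ne ((hΦ.2.2 p hps).1 hpD) (Ne.symm hne)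
  refine hp.2 (mem_interior_iff_mem_nhds.2 ?_)
  have h1 : ∀ᶠ q in 𝓝 p, 0 < (Φ q).1 :=
    (continuous_fst.continuousAt.comp (Φ.continuousAt hps)).eventually_const_lt hpos
  filter_upwards [h1, Φ.open_source.mem_nhds hps] with q hq hqs
  exact (hΦ.2.2 q hqs).2 hq.le

/-- The slice `t = 0` of the chart maps into `D`, so an extremum relative to `D` restricts to one
along the boundary. -/
theorem IsBoundaryChart.isLocalExtr_chartHeight (hΦ : IsBoundaryChart D Φ) {p : Euc (m + 1)}
    (hpD : p ∈ D) (hps : p ∈ Φ.source) (h : IsLocalExtrOn proj D p) :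
    IsLocalExtr (chartHeight Φ) (Φ p).2 := by
  have hp0 := hΦ.fst_eq_zero hpD (mem_frontier_of_isLocalExtrOn hpD h) hps
  have hΦp : ((0 : ℝ), (Φ p).2) = Φ p := Prod.ext hp0.symm rfl
  have hsymm : Φ.symm (0, (Φ p).2) = p := by rw [hΦp, Φ.left_inv hps]
  have htar : ((0 : ℝ), (Φ p).2) ∈ Φ.target := hΦp ▸ Φ.map_source hps
  have hmk : Continuous fun y : Euc m => ((0 : ℝ), y) := by fun_prop
  have hev : ∀ᶠ y in 𝓝 (Φ p).2, ((0 : ℝ), y) ∈ Φ.target :=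
    hmk.continuousAt (Φ.open_target.mem_nhds htar)
  refine IsExtrFilter.comp_tendsto (g := fun y => Φ.symm (0, y)) (l := 𝓝[D] p) (f := proj)
    (hsymm.symm ▸ h) (tendsto_nhdsWithin_iff.2 ⟨?_, ?_⟩)
  · have := (Φ.continuousAt_symm htar).comp (f := fun y : Euc m => ((0 : ℝ), y)) hmk.continuousAt
    rw [ContinuousAt] at this
    simpa [Function.comp_def, hsymm] using this
  · filter_upwards [hev] with y hy using hΦ.symm_mem hy le_rfl

theorem IsBoundaryChart.contDiffAt_chartHeight (hΦ : IsBoundaryChart D Φ) {y : Euc m}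
    (hy : ((0 : ℝ), y) ∈ Φ.target) : ContDiffAt ℝ ∞ (chartHeight Φ) y := by
  have h1 : ContDiffAt ℝ ∞ Φ.symm ((0 : ℝ), y) := hΦ.2.1.contDiffAt (Φ.open_target.mem_nhds hy)
  have h2 : ContDiffAt ℝ ∞ (fun y : Euc m => Φ.symm ((0 : ℝ), y)) y :=
    h1.comp y (contDiffAt_const.prodMk contDiffAt_id)
  exact (EuclideanSpace.proj (𝕜 := ℝ) (0 : Fin (m + 1))).contDiff.contDiffAt.comp y h2

/-- A nondegenerate critical point is the only point near it at which `π|_D` is extremal. -/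
theorem IsNondegenerateCriticalPt.eventually_not_isLocalExtrOn {p : Euc (m + 1)}
    (hp : IsNondegenerateCriticalPt D p) (hD : IsClosed D) :
    ∀ᶠ q in 𝓝[≠] p, q ∈ D → ¬ IsLocalExtrOn proj D q := by
  obtain ⟨hfr, Φ, hΦ, hps, -, hnd⟩ := hp
  have hp0 := hΦ.fst_eq_zero (hD.frontier_subset hfr) hfr hps
  have hΦp : ((0 : ℝ), (Φ p).2) = Φ p := Prod.ext hp0.symm rfl
  have hcd := hΦ.contDiffAt_chartHeight (y := (Φ p).2) (hΦp ▸ Φ.map_source hps)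
  have hd : DifferentiableAt ℝ (fderiv ℝ (chartHeight Φ)) (Φ p).2 :=
    (hcd.fderiv_right (m := 1) (by norm_cast)).differentiableAt one_ne_zero
  have hker : LinearMap.ker (fderiv ℝ (fderiv ℝ (chartHeight Φ)) (Φ p).2).toLinearMap = ⊥ := by
    refine LinearMap.ker_eq_bot'.2 fun v hv => hnd v fun w => ?_
    exact DFunLike.congr_fun (show fderiv ℝ (fderiv ℝ (chartHeight Φ)) (Φ p).2 v = 0 from hv) w
  -- In finite dimension an injective Hessian is bounded below, so the first derivative does not
  -- vanish at nearby points other than the critical one.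
  obtain ⟨C, -, hC⟩ := LinearMap.exists_antilipschitzWith _ hker
  have hne := hd.hasFDerivAt.eventually_ne (c := 0) ⟨C, hC⟩
  rw [eventually_nhdsWithin_iff] at hne ⊢
  have hcont : ContinuousAt (fun q => (Φ q).2) p :=
    continuous_snd.continuousAt.comp (Φ.continuousAt hps)
  filter_upwards [hcont.eventually hne, Φ.open_source.mem_nhds hps] with q hq hqs hqp hqD hqe
  refine hq (fun h2 => hqp ?_) (hΦ.isLocalExtr_chartHeight hqD hqs hqe).fderiv_eq_zero
  have hq0 := hΦ.fst_eq_zero hqD (mem_frontier_of_isLocalExtrOn hqD hqe) hqs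
  exact Φ.injOn hqs hps (Prod.ext (hq0.trans hp0.symm) h2)

/-- A local extremum of the height on the Reeb space is represented by a single point, which is a
critical point. -/
theorem isCriticalPt_and_eq_of_isLocalExtr (hD : IsDomainOfFiniteType D) {x : D}
    (h : IsLocalExtr (reebHeight D) (reebMk D x)) :
    IsCriticalPt D x ∧ ∀ y : D, reebMk D y = reebMk D x → y = x := by
  have hloc : ∀ y : D, reebMk D y = reebMk D x → IsLocalExtrOn proj D (y : Euc (m + 1)) :=
    fun y hy => isLocalExtrOn_proj_of_reebHeight (hy ▸ h)
  have hcrit : IsCriticalPt D x := by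
    have hfr := mem_frontier_of_isLocalExtrOn x.2 (hloc x rfl)
    obtain ⟨Φ, hΦ, hxs⟩ := hD.smooth.2 x hfr
    exact ⟨hfr, Φ, hΦ, hxs,
      (hΦ.isLocalExtr_chartHeight x.2 hxs (hloc x rfl)).fderiv_eq_zero⟩
  refine ⟨hcrit, fun y hy => ?_⟩
  set C := connectedComponentIn (slab D {proj (x : Euc (m + 1))}) (x : Euc (m + 1)) with hCdef
  have hxC : (x : Euc (m + 1)) ∈ C := mem_connectedComponentIn ⟨x.2, rfl⟩
  have hyC : (y : Euc (m + 1)) ∈ C := Quotient.exact hy.symm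
  have hCD : ∀ z ∈ C, ∃ hz : z ∈ D, reebMk D ⟨z, hz⟩ = reebMk D x := fun z hz =>
    ⟨(connectedComponentIn_subset _ _ hz).1, (Quotient.sound hz : reebMk D x = _).symm⟩
  have hev := (hD.morse _ hcrit).eventually_not_isLocalExtrOn hD.smooth.1
  rw [eventually_nhdsWithin_iff] at hev
  obtain ⟨U, hU, hUo, hxU⟩ := mem_nhds_iff.1 hev
  -- Every point of `C` is an extremum of `π|_D`, so `x` is isolated in `C`.
  have hUC : ∀ z ∈ C ∩ U, z = x := by
    rintro z ⟨hzC, hzU⟩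
    by_contra hne
    obtain ⟨hz, hzx⟩ := hCD z hzC
    exact hU hzU hne hz (hloc _ hzx)
  by_contra hne
  have hyx : (y : Euc (m + 1)) ≠ x := fun h => hne (Subtype.ext h)
  -- If `C` had a second point, the open cover by `U` and the complement of `x` would overlap on
  -- `C`, against isolation.
  obtain ⟨z, hzC, hzU, hzx⟩ := isPreconnected_connectedComponentIn U {(x : Euc (m + 1))}ᶜ hUo
    isOpen_compl_singleton (fun z _ => by by_cases hz : z = x <;> simp [hz, hxU])
    ⟨x, hxC, hxU⟩ ⟨y, hyC, hyx⟩
  exact hzx (hUC z ⟨hzC, hzU⟩)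

end Domain

/-! ### Punctured neighbourhoods of boundary points -/

section Domain

variable {m : ℕ} {D : Set (Euc (m + 1))}

/-- A punctured half-ball is connected. -/
theorem isPreconnected_halfBall_diff (y : Euc m) {r : ℝ} (hr : 0 < r) :
    IsPreconnected ({z ∈ Metric.ball ((0 : ℝ), y) r | 0 ≤ z.1} \ {((0 : ℝ), y)}) := by
  have hP : IsPreconnected (Set.Ioo 0 r ×ˢ Metric.ball y r) :=
    ((convex_Ioo 0 r).prod (convex_ball y r)).isPreconnected
  -- Balls of the product are boxes, so the punctured half-ball lies between the convex open
  -- half-box and its closure.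
  refine hP.subset_closure ?_ ?_
  · rintro ⟨t, z⟩ ⟨⟨ht0, htr⟩, hz⟩
    refine ⟨⟨?_, ht0.le⟩, fun h => ht0.ne' (congrArg Prod.fst h)⟩
    rw [← ball_prod_same]
    exact ⟨by simpa [abs_of_pos ht0] using htr, hz⟩
  · rintro ⟨t, z⟩ ⟨⟨hz, ht0⟩, -⟩
    rw [← ball_prod_same] at hz
    rw [closure_prod_eq, closure_Ioo hr.ne]
    exact ⟨⟨ht0, (le_abs_self t).trans (by simpa using (Metric.mem_ball.1 hz.1).le)⟩, subset_closure hz.2⟩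

/-- A boundary point of a smooth domain has arbitrarily small connected punctured
neighbourhoods. -/
theorem IsClosedSmoothDomain.exists_isPreconnected_punctured (hD : IsClosedSmoothDomain D) {x : D}
    (hx : (x : Euc (m + 1)) ∈ frontier D) {N : Set D} (hN : N ∈ 𝓝 x) :
    ∃ A ⊆ N \ {x}, IsPreconnected A ∧ A.Nonempty ∧ insert x A ∈ 𝓝 x := by
  obtain ⟨Φ, hΦ, hxs⟩ := hD.2 x hx
  obtain ⟨W, hW, hWN⟩ := mem_nhds_subtype _ _ _ |>.1 hN
  have hx0 := hΦ.fst_eq_zero x.2 hx hxs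
  have hΦx : ((0 : ℝ), (Φ x).2) = Φ x := Prod.ext hx0.symm rfl
  have hmem : Φ.symm ⁻¹' W ∩ Φ.target ∈ 𝓝 (Φ x) :=
    inter_mem (Φ.continuousAt_symm (Φ.map_source hxs) (by rwa [Φ.left_inv hxs]))
      (Φ.open_target.mem_nhds (Φ.map_source hxs))
  obtain ⟨r, hr, hball⟩ := Metric.mem_nhds_iff.1 hmem
  have hpre := isPreconnected_halfBall_diff (Φ x).2 hr
  rw [hΦx] at hpre
  set H := {z ∈ Metric.ball (Φ x) r | 0 ≤ z.1} \ {Φ x} with hH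
  have hHt : ∀ z ∈ H, z ∈ Φ.target := fun z hz => (hball hz.1.1).2
  have himg : (Subtype.val '' {d : D | (d : Euc (m + 1)) ∈ Φ.source ∧ Φ d ∈ H}) = Φ.symm '' H := by
    ext q
    constructor
    · rintro ⟨d, ⟨hds, hd⟩, rfl⟩
      exact ⟨Φ d, hd, Φ.left_inv hds⟩
    · rintro ⟨z, hz, rfl⟩
      refine ⟨⟨Φ.symm z, hΦ.symm_mem (hHt z hz) hz.1.2⟩, ⟨Φ.map_target (hHt z hz), ?_⟩, rfl⟩
      rwa [Φ.right_inv (hHt z hz)]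
  refine ⟨{d : D | (d : Euc (m + 1)) ∈ Φ.source ∧ Φ d ∈ H}, ?_, ?_, ?_, ?_⟩
  · rintro d ⟨hds, hd⟩
    refine ⟨hWN ?_, fun h => hd.2 ?_⟩
    · have := (hball hd.1.1).1
      rwa [Set.mem_preimage, Φ.left_inv hds] at this
    · rw [show d = x from h]; rfl
  · rw [← IsInducing.subtypeVal.isPreconnected_image, himg]
    exact hpre.image _ (Φ.continuousOn_symm.mono hHt)
  · rw [← Set.image_nonempty (f := Subtype.val), himg, Set.image_nonempty]
    refine ⟨(r / 2, (Φ x).2), ⟨?_, (half_pos hr).le⟩, fun h => ?_⟩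
    · rw [← hΦx, ← ball_prod_same]
      exact ⟨by simp [abs_of_pos hr, hr], Metric.mem_ball_self hr⟩
    · have := congrArg Prod.fst (show _ = _ from h)
      rw [hx0] at this
      exact (half_pos hr).ne' this
  · have h1 : ∀ᶠ d : D in 𝓝 x, (d : Euc (m + 1)) ∈ Φ.source ∧ Φ d ∈ Metric.ball (Φ x) r :=
      continuous_subtype_val.continuousAt.eventually
        ((Φ.open_source.eventually_mem hxs).and
          ((Φ.continuousAt hxs).eventually (Metric.ball_mem_nhds _ hr)))
    filter_upwards [h1] with d hd
    by_cases hdx : d = x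
    · exact Or.inl hdx
    · refine Or.inr ⟨hd.1, ⟨hd.2, (hΦ.2.2 d hd.1).1 d.2⟩, fun h => hdx ?_⟩
      exact Subtype.ext (Φ.injOn hd.1 hxs h)

end Domain

/-! ### Transfer to the graph -/

namespace ReebRealization

variable {V E : Type*} {Γ : MGraph V E} {m : ℕ} {D : Set (Euc (m + 1))} (R : ReebRealization Γ D)

/-- The quotient map, with values in the realization of the graph. -/
def toGraph (x : D) : Γ.Realization := R.homeo.symm (reebMk D x)

theorem continuous_toGraph : Continuous R.toGraph := R.homeo.symm.continuous.comp continuous_reebMk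

theorem toGraph_surjective : Function.Surjective R.toGraph :=
  R.homeo.symm.surjective.comp Quotient.mk_surjective

theorem reebHeight_homeo_toGraph (x : D) :
    reebHeight D (R.homeo (R.toGraph x)) = proj (x : Euc (m + 1)) := by
  rw [toGraph, R.homeo.apply_symm_apply]
  rfl

theorem continuous_height : Continuous fun p => reebHeight D (R.homeo p) :=
  continuous_reebHeight.comp R.homeo.continuous

/-- At a vertex represented by a single point, images of neighbourhoods are neighbourhoods. -/
theorem image_toGraph_mem_nhds (hD : IsDomainOfFiniteType D) {v : V} {x : D}
    (hx : R.toGraph x = Γ.vertex v) (huniq : ∀ y, R.toGraph y = Γ.vertex v → y = x) {B : Set D}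
    (hB : B ∈ 𝓝 x) : R.toGraph '' B ∈ 𝓝 (Γ.vertex v) := by
  -- Properness makes compact the part of `D` outside `interior B` at heights within `1` of `x`. It
  -- misses the fibre `{x}`, so the distance to `v` has a positive lower bound `ε` on it. A point of
  -- `|Γ|` with height within `1` and distance below `ε` can then only come from `B`.
  have hK : IsCompact ((fun y : D => proj (y : Euc (m + 1))) ⁻¹'
      Metric.closedBall (proj (x : Euc (m + 1))) 1 \ interior B) :=
    (hD.proper.isCompact_preimage (isCompact_closedBall _ _)).diff isOpen_interior
  obtain ⟨ε, hε, hεK⟩ := hK.exists_forall_le' (a := 0)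
    ((Γ.continuous_vertexDist v).comp R.continuous_toGraph).continuousOn fun y hy => by
      refine lt_of_le_of_ne (Γ.vertexDist_nonneg v _) fun h => hy.2 ?_
      rw [huniq y (Γ.vertexDist_eq_zero h.symm)]
      exact mem_interior_iff_mem_nhds.2 hB
  have h1 : ∀ᶠ p in 𝓝 (Γ.vertex v), Γ.vertexDist v p < ε :=
    (Γ.continuous_vertexDist v).continuousAt.eventually_lt_const (by simpa [Γ.vertexDist_vertex])
  have h2 : ∀ᶠ p in 𝓝 (Γ.vertex v),
      reebHeight D (R.homeo p) ∈ Metric.closedBall (proj (x : Euc (m + 1))) 1 := by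
    refine R.continuous_height.continuousAt (Metric.closedBall_mem_nhds_of_mem ?_)
    rw [← hx, reebHeight_homeo_toGraph]
    exact Metric.mem_ball_self one_pos
  filter_upwards [h1, h2] with p hp1 hp2
  obtain ⟨y, rfl⟩ := R.toGraph_surjective p
  rw [reebHeight_homeo_toGraph] at hp2
  refine ⟨y, ?_, rfl⟩
  by_contra hy
  exact (hεK y ⟨hp2, fun h => hy (interior_subset h)⟩).not_gt hp1

/-- A local extremum of the height is a vertex of degree `1`. -/
theorem exists_vertex_of_isLocalExtr (hD : IsDomainOfFiniteType D) {p : Γ.Realization}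
    (hp : IsLocalExtr (fun p => reebHeight D (R.homeo p)) p) :
    ∃ v, Γ.vertex v = p ∧ Γ.degree v = 1 := by
  obtain ⟨x, rfl⟩ := R.toGraph_surjective p
  have hext : IsLocalExtr (reebHeight D) (reebMk D x) := by
    have := hp.comp_continuous (g := R.homeo.symm) (b := reebMk D x)
      R.homeo.symm.continuous.continuousAt
    simpa [Function.comp_def] using this
  obtain ⟨hcrit, hfib⟩ := isCriticalPt_and_eq_of_isLocalExtr hD hext
  -- Classes of critical points are Reeb vertices by definition, so the extremum sits at a vertex of
  -- `Γ`.
  obtain ⟨v, hv⟩ := R.onVertices.surjective ⟨reebMk D x, x, hcrit, rfl⟩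
  have hvx : R.toGraph x = Γ.vertex v := by
    rw [toGraph, Homeomorph.symm_apply_eq, R.homeo_vertex, hv]
  have huniq : ∀ y, R.toGraph y = Γ.vertex v → y = x := fun y hy =>
    hfib y (R.homeo.symm.injective (hy.trans hvx.symm))
  refine ⟨v, hvx.symm, Γ.degree_eq_one_of_isPreconnected fun N hN => ?_⟩
  rw [← hvx] at hN
  obtain ⟨A, hAN, hA, hne, hAx⟩ := hD.smooth.exists_isPreconnected_punctured hcrit.1
    (R.continuous_toGraph.continuousAt hN)
  -- The image of `A` avoids the vertex because `x` is the only point over it.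
  refine ⟨R.toGraph '' A, ?_, hA.image _ R.continuous_toGraph.continuousOn, hne.image _, ?_⟩
  · rintro _ ⟨a, ha, rfl⟩
    exact ⟨(hAN ha).1, fun h => (hAN ha).2 (huniq a h)⟩
  · rw [← hvx, ← Set.image_insert_eq, hvx]
    exact R.image_toGraph_mem_nhds hD hvx huniq hAx

theorem isGoodOrientation (hD : IsDomainOfFiniteType D) :
    Γ.IsGoodOrientation (fun p => reebHeight D (R.homeo p)) := by
  have hmono := Γ.strictMono_or_strictAnti_edge R.continuous_height fun p hp =>
    (R.exists_vertex_of_isLocalExtr hD hp).imp fun _ h => h.1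
  refine ⟨R.continuous_height, hmono, fun p => ⟨R.exists_vertex_of_isLocalExtr hD, ?_⟩⟩
  rintro ⟨v, rfl, hv⟩
  exact Γ.isLocalExtr_of_degree_eq_one hmono hv

end ReebRealization

theorem mainTheorem6 {V E : Type*} (Γ : MGraph V E) {m : ℕ} (hm : 1 ≤ m)
    (D : Set (Euc (m + 1))) (hD : IsDomainOfFiniteType D) (R : ReebRealization Γ D) :
    Γ.IsGoodOrientation (fun p => reebHeight D (R.homeo p)) ∧
      ∀ j : Γ.Realization → Euc (m + 1), R.IsCompatibleEmbedding j →
        Γ.IsGoodOrientation (fun p => proj (j p)) := by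
  refine ⟨R.isGoodOrientation hD, fun j hj => ?_⟩
  rw [show (fun p => proj (j p)) = fun p => reebHeight D (R.homeo p) from funext hj.proj_eq]
  exact R.isGoodOrientation hD
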